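/- Let $(\Omega,\mathcal F,\mathbb P)$ be a complete probability space with a filtration $\mathbb F=(\mathcal F_s)_{s\ge 0}$ satisfying the usual conditions, and let $W$ be a standard Brownian motion with respect to $\mathbb F$. Let $\mu\in\mathbb R$, $\sigma>0$, $r>0$, $T\in(0,\infty)$ and $0\le\eta<\kappa$. For $x\ge 0$ let $S(x):=\inf\{s\ge 0:\ x+\mu s+\sigma W_s=0\}$ (with $\inf\emptyset=+\infty$), and for $h\ge 0$ let $\Lambda(h)$ be the set of all $\mathbb F$-stopping times with values in $[0,h]$ a.s. For $(t,x)\in[0,T]\times[0,\infty)$ put $$u(t,x):=\sup_{\tau\in\Lambda(T-t)}\mathbb E\Big[e^{-r\tau}\eta\,\mathbf 1_{\{\tau<S(x)\}}+e^{-rS(x)}\kappa\,\mathbf 1_{\{\tau\ge S(x)\}}\Big].$$ Then these expectations and the supremum are well defined and finite, and (i) $u(T,x)=\eta$ for every $x>0$, and $u(t,0)=\kappa$ for every $t\in[0,T]$; (ii) $t\mapsto u(t,x)$ is nonincreasing on $[0,T]$ for every $x>0$; (iii) $x\mapsto u(t,x)$ is nonincreasing on $[0,\infty)$ for every $t\in[0,T]$.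 -/

import Mathlib

open MeasureTheory ProbabilityTheory
open scoped NNReal

namespace DividendStopping

variable {Ω : Type*} {mΩ : MeasurableSpace Ω}

/-- The usual conditions on a filtered probability space: the filtration is right-continuous and
its initial σ-algebra contains every set of outer measure zero. -/
structure UsualConditions (𝓕 : Filtration ℝ≥0 mΩ) (P : Measure Ω) : Prop where
  rightContinuous : 𝓕.IsRightContinuous
  null_measurable : ∀ A : Set Ω, P A = 0 → MeasurableSet[𝓕 0] A

/-- `W` is a standard Brownian motion with respect to the filtration `𝓕`: it has the law of
Brownian motion and almost surely continuous paths, it is adapted to `𝓕`, and the increment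
`W t - W s` is independent of `𝓕 s` for all `s ≤ t`. -/
structure IsFilteredBrownian (W : ℝ≥0 → Ω → ℝ) (𝓕 : Filtration ℝ≥0 mΩ) (P : Measure Ω) : Prop
    extends IsBrownianReal W P where
  adapted : Adapted 𝓕 W
  indep_increment : ∀ s t : ℝ≥0, s ≤ t →
    Indep (MeasurableSpace.comap (fun ω ↦ W t ω - W s ω) inferInstance) (𝓕 s) P

/-- The drifted Brownian motion `x + μ s + σ W_s`. -/
def driftedBM (μ σ : ℝ) (W : ℝ≥0 → Ω → ℝ) (x : ℝ) (s : ℝ≥0) (ω : Ω) : ℝ :=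
  x + μ * s + σ * W s ω

/-- The absorption time `S(x) = inf {s ≥ 0 : x + μ s + σ W_s = 0}`, equal to `⊤` when the path
never vanishes. -/
noncomputable def absorptionTime (μ σ : ℝ) (W : ℝ≥0 → Ω → ℝ) (x : ℝ) : Ω → WithTop ℝ≥0 :=
  hittingAfter (driftedBM μ σ W x) {0} 0

/-- The discount factor `e ^ (-r s)`, with the convention `e ^ (-∞) = 0`. -/
noncomputable def discount (r : ℝ) : WithTop ℝ≥0 → ℝ
  | ⊤ => 0
  | (s : ℝ≥0) => Real.exp (-r * s)

/-- `Λ(h)`: the stopping times of the filtration `𝓕` with values in `[0, h]` almost surely. -/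
def stoppingTimes (𝓕 : Filtration ℝ≥0 mΩ) (P : Measure Ω) (h : ℝ≥0) : Set (Ω → WithTop ℝ≥0) :=
  {τ | IsStoppingTime 𝓕 τ ∧ ∀ᵐ ω ∂P, τ ω ≤ (h : WithTop ℝ≥0)}

open scoped Classical in
/-- The reward `e ^ (-r τ) η 1_{τ < S(x)} + e ^ (-r S(x)) κ 1_{τ ≥ S(x)}` of stopping at `τ`. -/
noncomputable def reward (μ σ r η κ : ℝ) (W : ℝ≥0 → Ω → ℝ) (x : ℝ) (τ : Ω → WithTop ℝ≥0)
    (ω : Ω) : ℝ :=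
  discount r (τ ω) * η * (if τ ω < absorptionTime μ σ W x ω then 1 else 0)
    + discount r (absorptionTime μ σ W x ω) * κ *
      (if absorptionTime μ σ W x ω ≤ τ ω then 1 else 0)

/-- The set of expected rewards attained by the stopping times in `Λ(T - t)`. -/
noncomputable def expectedRewards (μ σ r η κ : ℝ) (T : ℝ≥0) (W : ℝ≥0 → Ω → ℝ)
    (𝓕 : Filtration ℝ≥0 mΩ) (P : Measure Ω) (t : ℝ≥0) (x : ℝ) : Set ℝ :=
  (fun τ ↦ ∫ ω, reward μ σ r η κ W x τ ω ∂P) '' stoppingTimes 𝓕 P (T - t)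

/-- The value function `u(t, x)` of the optimal stopping problem, meant for `0 ≤ t ≤ T` and
`0 ≤ x`. -/
noncomputable def value (μ σ r η κ : ℝ) (T : ℝ≥0) (W : ℝ≥0 → Ω → ℝ)
    (𝓕 : Filtration ℝ≥0 mΩ) (P : Measure Ω) (t : ℝ≥0) (x : ℝ) : ℝ :=
  sSup (expectedRewards μ σ r η κ T W 𝓕 P t x)

end DividendStopping

/-!
Everything happens path by path. The path started at a point `x ≠ 0` is not absorbed at once, so at
the horizon `t = T`, where only `τ = 0` is allowed, the reward is `η`; the path started at `0` is
absorbed at once, so the reward is `κ`. Shrinking the horizon shrinks the set of stopping times.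
Lowering the starting point `x ≥ 0` lowers the whole path, which by the intermediate value theorem
is then absorbed no later; this can only increase the reward of a given `τ`, since `η ≤ κ` and the
discount factor decreases. The expectations make sense because a continuous path meets a closed set
during a compact time interval exactly when its distances to the set at a countable dense set of
times have infimum zero, which makes `S(x)` a.e. measurable.
-/

namespace DividendStopping

section HittingTime

open Metric

variable {ι Ω β : Type*} [ConditionallyCompleteLinearOrder ι]

lemma le_hittingAfter_of_forall {X : ι → Ω → β} {s : Set β} {n : ι} {ω : Ω} {a : WithTop ι}
    (h : ∀ j, n ≤ j → X j ω ∈ s → a ≤ j) : a ≤ hittingAfter X s n ω := by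
  unfold hittingAfter
  split_ifs with hne
  · obtain ⟨j, hj, hjs⟩ := hne
    lift a to ι using ne_top_of_le_ne_top WithTop.coe_ne_top (h j hj hjs)
    exact WithTop.coe_le_coe.2 (le_csInf ⟨j, hj, hjs⟩
      fun i hi ↦ WithTop.coe_le_coe.1 (h i hi.1 hi.2))
  · exact le_top

variable [TopologicalSpace ι] [OrderTopology ι]

lemma hittingAfter_le_iff_of_isClosed [TopologicalSpace β] {X : ι → Ω → β} {s : Set β} {n i : ι}
    {ω : Ω} (hX : Continuous (X · ω)) (hs : IsClosed s) :
    hittingAfter X s n ω ≤ i ↔ ∃ j ∈ Set.Icc n i, X j ω ∈ s := by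
  refine ⟨fun h ↦ ?_, fun ⟨j, hj, hjs⟩ ↦
    (hittingAfter_le_of_mem hj.1 hjs).trans (WithTop.coe_le_coe.2 hj.2)⟩
  unfold hittingAfter at h
  split_ifs at h with hne
  · have hmem : sInf {j | n ≤ j ∧ X j ω ∈ s} ∈ {j | n ≤ j ∧ X j ω ∈ s} :=
      (isClosed_Ici.inter (hs.preimage hX)).csInf_mem hne ⟨n, fun _ hj ↦ hj.1⟩
    exact ⟨_, ⟨hmem.1, WithTop.coe_le_coe.1 h⟩, hmem.2⟩
  · exact absurd h (WithTop.not_top_le_coe i)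

lemma hittingAfter_singleton_le_of_le [DenselyOrdered ι] [LinearOrder β] [TopologicalSpace β]
    [OrderClosedTopology β] {X Y : ι → Ω → β} {a : β} {n : ι} {ω : Ω}
    (hX : Continuous (X · ω)) (ha : a ≤ X n ω) (hXY : ∀ j, n ≤ j → X j ω ≤ Y j ω) :
    hittingAfter X {a} n ω ≤ hittingAfter Y {a} n ω := by
  refine le_hittingAfter_of_forall fun j hnj hYj ↦ ?_
  have hXj : X j ω ≤ a := (hXY j hnj).trans_eq hYj
  obtain ⟨i, hi, hXi⟩ := intermediate_value_Icc' hnj hX.continuousOn ⟨hXj, ha⟩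
  exact (hittingAfter_le_of_mem hi.1 hXi).trans (WithTop.coe_le_coe.2 hi.2)

lemma exists_mem_iff_iInf_infEDist_eq_zero {K : Type*} [TopologicalSpace K] [CompactSpace K]
    [PseudoEMetricSpace β] {f : K → β} (hf : Continuous f) {s : Set β} (hs : IsClosed s) :
    (∃ j, f j ∈ s) ↔ ⨅ j, infEDist (f j) s = 0 := by
  constructor
  · rintro ⟨j, hj⟩
    exact le_antisymm ((iInf_le _ j).trans_eq (infEDist_zero_of_mem hj)) zero_le
  · intro h
    cases isEmpty_or_nonempty K with
    | inl _ => exact absurd h (by simp [iInf_of_empty])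
    | inr _ =>
      obtain ⟨j, hj⟩ := (isCompact_range (continuous_infEDist.comp hf)).sInf_mem
        (Set.range_nonempty _)
      exact ⟨j, (mem_iff_infEDist_zero_of_closed hs).2 (hj.trans h)⟩

lemma hittingAfter_le_iff_iInf_infEDist_eq_zero [PseudoEMetricSpace β] {X : ι → Ω → β} {s : Set β}
    {n i : ι} {ω : Ω} (hX : Continuous (X · ω)) (hs : IsClosed s) {D : Set (Set.Icc n i)}
    (hD : Dense D) : hittingAfter X s n ω ≤ i ↔ ⨅ j : D, infEDist (X j ω) s = 0 := by
  have hXIcc : Continuous fun j : Set.Icc n i ↦ X j ω := hX.comp continuous_subtype_val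
  have hdist : Continuous fun j : Set.Icc n i ↦ infEDist (X j ω) s :=
    continuous_infEDist.comp hXIcc
  rw [hD.ciInf' hdist, ← exists_mem_iff_iInf_infEDist_eq_zero hXIcc hs,
    hittingAfter_le_iff_of_isClosed hX hs, Subtype.exists]
  simp only [exists_prop]

lemma aemeasurable_hittingAfter [SecondCountableTopology ι] [PseudoEMetricSpace β]
    [MeasurableSpace β] [OpensMeasurableSpace β] {mΩ : MeasurableSpace Ω} {P : Measure Ω}
    {X : ι → Ω → β} (hX : ∀ j, AEMeasurable (X j) P) (hc : ∀ᵐ ω ∂P, Continuous (X · ω))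
    {s : Set β} (hs : IsClosed s) (n : ι) : AEMeasurable (hittingAfter X s n) P := by
  refine NullMeasurable.aemeasurable (measurable_of_Iic (δ := NullMeasurableSpace Ω P) fun a ↦ ?_)
  cases a with
  | top => rw [Set.Iic_top]; exact .univ
  | coe i =>
    obtain ⟨D, hD, hdense⟩ := TopologicalSpace.exists_countable_dense (Set.Icc n i)
    have := hD.to_subtype
    have hdist : AEMeasurable (fun ω ↦ ⨅ j : D, infEDist (X j ω) s) P :=
      .iInf fun j ↦ measurable_infEDist.comp_aemeasurable (hX j)
    refine (hdist.nullMeasurable (measurableSet_singleton 0)).congr ?_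
    filter_upwards [hc] with ω hω
    exact propext (hittingAfter_le_iff_iInf_infEDist_eq_zero hω hs hdense).symm

end HittingTime

section Discount

lemma discount_coe (r : ℝ) (s : ℝ≥0) : discount r (s : WithTop ℝ≥0) = Real.exp (-r * s) := rfl

lemma discount_zero (r : ℝ) : discount r 0 = 1 := by
  rw [← WithTop.coe_zero, discount_coe, NNReal.coe_zero, mul_zero, Real.exp_zero]

lemma discount_nonneg (r : ℝ) (s : WithTop ℝ≥0) : 0 ≤ discount r s := by
  cases s with
  | top => exact le_rfl
  | coe s => exact (Real.exp_pos _).le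

lemma discount_antitone {r : ℝ} (hr : 0 ≤ r) : Antitone (discount r) := by
  intro s t hst
  cases t with
  | top => exact discount_nonneg r s
  | coe t =>
    lift s to ℝ≥0 using ne_top_of_le_ne_top WithTop.coe_ne_top hst
    have hst' : (s : ℝ) ≤ t := mod_cast hst
    exact Real.exp_le_exp.2 (mul_le_mul_of_nonpos_left hst' (neg_nonpos.2 hr))

lemma discount_le_one {r : ℝ} (hr : 0 ≤ r) (s : WithTop ℝ≥0) : discount r s ≤ 1 :=
  (discount_antitone hr zero_le).trans_eq (discount_zero r)

lemma measurable_discount (r : ℝ) : Measurable (discount r) :=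
  WithTop.measurable_of_measurable_comp_coe <| by simp only [discount_coe]; fun_prop

end Discount

section AbsorptionTime

variable {Ω : Type*} {W : ℝ≥0 → Ω → ℝ} {μ σ x y : ℝ} {ω : Ω}

lemma continuous_driftedBM (hc : Continuous (W · ω)) :
    Continuous (driftedBM μ σ W x · ω) := by
  unfold driftedBM; fun_prop

lemma driftedBM_zero (h0 : W 0 ω = 0) : driftedBM μ σ W x 0 ω = x := by
  simp [driftedBM, h0]

lemma absorptionTime_zero (h0 : W 0 ω = 0) : absorptionTime μ σ W 0 ω = 0 :=
  le_antisymm (hittingAfter_le_of_mem le_rfl (driftedBM_zero h0)) zero_le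

lemma absorptionTime_pos (hc : Continuous (W · ω)) (h0 : W 0 ω = 0) (hx : x ≠ 0) :
    0 < absorptionTime μ σ W x ω := by
  by_contra! h
  obtain ⟨s, hs, hs0⟩ := (hittingAfter_le_iff_of_isClosed (i := 0)
    (continuous_driftedBM hc) isClosed_singleton).1 h
  obtain rfl : s = 0 := le_antisymm hs.2 hs.1
  exact hx ((driftedBM_zero h0).symm.trans hs0)

lemma absorptionTime_mono (hc : Continuous (W · ω)) (h0 : W 0 ω = 0) (hx : 0 ≤ x) (hxy : x ≤ y) :
    absorptionTime μ σ W x ω ≤ absorptionTime μ σ W y ω :=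
  hittingAfter_singleton_le_of_le (continuous_driftedBM hc) (by rwa [driftedBM_zero h0])
    fun _ _ ↦ by unfold driftedBM; gcongr

lemma aemeasurable_absorptionTime {_ : MeasurableSpace Ω} {P : Measure Ω}
    (hW : ∀ s, AEMeasurable (W s) P) (hc : ∀ᵐ ω ∂P, Continuous (W · ω)) :
    AEMeasurable (absorptionTime μ σ W x) P :=
  aemeasurable_hittingAfter (fun s ↦ ((hW s).const_mul σ).const_add (x + μ * s))
    (hc.mono fun _ ↦ continuous_driftedBM) isClosed_singleton 0

end AbsorptionTime

section Reward

variable {Ω : Type*} {W : ℝ≥0 → Ω → ℝ} {μ σ r η κ x y : ℝ} {τ : Ω → WithTop ℝ≥0} {ω : Ω}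

lemma reward_of_lt (h : τ ω < absorptionTime μ σ W x ω) :
    reward μ σ r η κ W x τ ω = discount r (τ ω) * η := by
  simp [reward, h, h.not_ge]

lemma reward_of_le (h : absorptionTime μ σ W x ω ≤ τ ω) :
    reward μ σ r η κ W x τ ω = discount r (absorptionTime μ σ W x ω) * κ := by
  simp [reward, h, h.not_gt]

lemma abs_reward_le (hr : 0 ≤ r) : |reward μ σ r η κ W x τ ω| ≤ max |η| |κ| := by
  have abs_discount_mul_le (s : WithTop ℝ≥0) (c : ℝ) : |discount r s * c| ≤ |c| := by
    rw [abs_mul, abs_of_nonneg (discount_nonneg r s)]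
    exact mul_le_of_le_one_left (abs_nonneg c) (discount_le_one hr s)
  rcases lt_or_ge (τ ω) (absorptionTime μ σ W x ω) with h | h
  · rw [reward_of_lt h]
    exact (abs_discount_mul_le _ η).trans (le_max_left _ _)
  · rw [reward_of_le h]
    exact (abs_discount_mul_le _ κ).trans (le_max_right _ _)

lemma reward_le_reward (hr : 0 ≤ r) (hκ : 0 ≤ κ) (hηκ : η ≤ κ)
    (hS : absorptionTime μ σ W x ω ≤ absorptionTime μ σ W y ω) :
    reward μ σ r η κ W y τ ω ≤ reward μ σ r η κ W x τ ω := by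
  rcases lt_or_ge (τ ω) (absorptionTime μ σ W x ω) with hx | hx
  · rw [reward_of_lt hx, reward_of_lt (hx.trans_le hS)]
  rw [reward_of_le hx]
  rcases lt_or_ge (τ ω) (absorptionTime μ σ W y ω) with hy | hy
  · rw [reward_of_lt hy]
    calc discount r (τ ω) * η ≤ discount r (τ ω) * κ :=
          mul_le_mul_of_nonneg_left hηκ (discount_nonneg r _)
      _ ≤ discount r (absorptionTime μ σ W x ω) * κ :=
          mul_le_mul_of_nonneg_right (discount_antitone hr hx) hκ
  · rw [reward_of_le hy]
    exact mul_le_mul_of_nonneg_right (discount_antitone hr hS) hκ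

variable {mΩ : MeasurableSpace Ω} {P : Measure Ω}

lemma aemeasurable_reward (hS : AEMeasurable (absorptionTime μ σ W x) P)
    (hτ : AEMeasurable τ P) : AEMeasurable (reward μ σ r η κ W x τ) P := by
  classical
  have hpayoff : Measurable fun p : WithTop ℝ≥0 × WithTop ℝ≥0 ↦
      discount r p.1 * η * (if p.1 < p.2 then 1 else 0)
        + discount r p.2 * κ * (if p.2 ≤ p.1 then 1 else 0) := by
    refine .add (.mul (((measurable_discount r).comp measurable_fst).mul_const η) ?_)
      (.mul (((measurable_discount r).comp measurable_snd).mul_const κ) ?_)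
    · exact .ite (measurableSet_lt measurable_fst measurable_snd) measurable_const measurable_const
    · exact .ite (measurableSet_le measurable_snd measurable_fst) measurable_const measurable_const
  convert hpayoff.comp_aemeasurable (hτ.prodMk hS) using 1
  ext ω
  simp [reward]

lemma integrable_reward [IsFiniteMeasure P] (hr : 0 ≤ r)
    (hS : AEMeasurable (absorptionTime μ σ W x) P) (hτ : AEMeasurable τ P) :
    Integrable (reward μ σ r η κ W x τ) P :=
  .of_bound (aemeasurable_reward hS hτ).aestronglyMeasurable _ (.of_forall fun _ ↦ abs_reward_le hr)

end Reward

section Value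

variable {Ω : Type*} {mΩ : MeasurableSpace Ω} {P : Measure Ω} {𝓕 : Filtration ℝ≥0 mΩ}
  {W : ℝ≥0 → Ω → ℝ} {μ σ r η κ x : ℝ} {T t : ℝ≥0}

lemma zero_mem_stoppingTimes (h : ℝ≥0) : (fun _ ↦ 0) ∈ stoppingTimes 𝓕 P h :=
  ⟨isStoppingTime_const 𝓕 0, .of_forall fun _ ↦ zero_le⟩

lemma stoppingTimes_mono : Monotone (stoppingTimes 𝓕 P) := fun _ _ h _ hτ ↦
  ⟨hτ.1, hτ.2.mono fun _ hω ↦ hω.trans (WithTop.coe_le_coe.2 h)⟩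

lemma expectedRewards_nonempty : (expectedRewards μ σ r η κ T W 𝓕 P t x).Nonempty :=
  ⟨_, _, zero_mem_stoppingTimes _, rfl⟩

lemma bddAbove_expectedRewards [IsFiniteMeasure P] (hr : 0 ≤ r) :
    BddAbove (expectedRewards μ σ r η κ T W 𝓕 P t x) := by
  refine ⟨max |η| |κ| * P.real Set.univ, ?_⟩
  rintro _ ⟨τ, -, rfl⟩
  calc ∫ ω, reward μ σ r η κ W x τ ω ∂P ≤ ‖∫ ω, reward μ σ r η κ W x τ ω ∂P‖ := Real.le_norm_self _
    _ ≤ max |η| |κ| * P.real Set.univ :=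
      norm_integral_le_of_norm_le_const (.of_forall fun _ ↦ abs_reward_le hr)

lemma isLUB_value [IsFiniteMeasure P] (hr : 0 ≤ r) :
    IsLUB (expectedRewards μ σ r η κ T W 𝓕 P t x) (value μ σ r η κ T W 𝓕 P t x) :=
  isLUB_csSup expectedRewards_nonempty (bddAbove_expectedRewards hr)

lemma value_eq_of_forall_ae_eq [IsProbabilityMeasure P] {c : ℝ}
    (h : ∀ τ ∈ stoppingTimes 𝓕 P (T - t), ∀ᵐ ω ∂P, reward μ σ r η κ W x τ ω = c) :
    value μ σ r η κ T W 𝓕 P t x = c := by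
  have hset : expectedRewards μ σ r η κ T W 𝓕 P t x = {c} := by
    refine Set.eq_singleton_iff_nonempty_unique_mem.2 ⟨expectedRewards_nonempty, ?_⟩
    rintro _ ⟨τ, hτ, rfl⟩
    simp [integral_congr_ae (h τ hτ)]
  rw [value, hset, csSup_singleton]

lemma value_terminal [IsProbabilityMeasure P] (hc : ∀ᵐ ω ∂P, Continuous (W · ω))
    (h0 : ∀ᵐ ω ∂P, W 0 ω = 0) (hx : x ≠ 0) : value μ σ r η κ T W 𝓕 P T x = η := by
  refine value_eq_of_forall_ae_eq fun τ hτ ↦ ?_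
  filter_upwards [hc, h0, hτ.2] with ω hcω h0ω hle
  have hτ0 : τ ω = 0 := le_antisymm (by simpa using hle) zero_le
  rw [reward_of_lt (hτ0 ▸ absorptionTime_pos hcω h0ω hx), hτ0, discount_zero, one_mul]

lemma value_zero [IsProbabilityMeasure P] (h0 : ∀ᵐ ω ∂P, W 0 ω = 0) :
    value μ σ r η κ T W 𝓕 P t 0 = κ := by
  refine value_eq_of_forall_ae_eq fun τ _ ↦ ?_
  filter_upwards [h0] with ω h0ω
  have hS : absorptionTime μ σ W 0 ω = 0 := absorptionTime_zero h0ω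
  rw [reward_of_le (hS ▸ zero_le), hS, discount_zero, one_mul]

lemma value_antitone_time [IsFiniteMeasure P] (hr : 0 ≤ r) :
    Antitone fun t ↦ value μ σ r η κ T W 𝓕 P t x := fun _ _ hst ↦
  csSup_le_csSup (bddAbove_expectedRewards hr) expectedRewards_nonempty
    (Set.image_mono (stoppingTimes_mono (tsub_le_tsub_left hst T)))

lemma value_antitoneOn_space [IsFiniteMeasure P] (hW : ∀ s, AEMeasurable (W s) P)
    (hc : ∀ᵐ ω ∂P, Continuous (W · ω)) (h0 : ∀ᵐ ω ∂P, W 0 ω = 0)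
    (hr : 0 ≤ r) (hκ : 0 ≤ κ) (hηκ : η ≤ κ) :
    AntitoneOn (fun x ↦ value μ σ r η κ T W 𝓕 P t x) (Set.Ici 0) := by
  intro x hx y _ hxy
  refine csSup_le expectedRewards_nonempty ?_
  rintro _ ⟨τ, hτ, rfl⟩
  have hint (z : ℝ) : Integrable (reward μ σ r η κ W z τ) P :=
    integrable_reward hr (aemeasurable_absorptionTime hW hc) hτ.1.measurable'.aemeasurable
  refine le_csSup_of_le (bddAbove_expectedRewards hr) ⟨τ, hτ, rfl⟩
    (integral_mono_ae (hint y) (hint x) ?_)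
  filter_upwards [hc, h0] with ω hcω h0ω
  exact reward_le_reward hr hκ hηκ (absorptionTime_mono hcω h0ω hx hxy)

end Value

end DividendStopping

open DividendStopping in
theorem proposition5p1_general {Ω : Type*} [mΩ : MeasurableSpace Ω] (P : Measure Ω)
    [IsProbabilityMeasure P] (𝓕 : Filtration ℝ≥0 mΩ) (W : ℝ≥0 → Ω → ℝ)
    (hW : ∀ s, AEMeasurable (W s) P) (hc : ∀ᵐ ω ∂P, Continuous (W · ω))
    (h0 : ∀ᵐ ω ∂P, W 0 ω = 0)
    (μ σ r η κ : ℝ) (hr : 0 ≤ r) (hκ : 0 ≤ κ) (hηκ : η ≤ κ) (T : ℝ≥0) :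
    (∀ t ∈ Set.Icc 0 T, ∀ x : ℝ,
      (∀ τ ∈ stoppingTimes 𝓕 P (T - t), Integrable (reward μ σ r η κ W x τ) P) ∧
      IsLUB (expectedRewards μ σ r η κ T W 𝓕 P t x) (value μ σ r η κ T W 𝓕 P t x)) ∧
    ((∀ x : ℝ, x ≠ 0 → value μ σ r η κ T W 𝓕 P T x = η) ∧
      (∀ t ∈ Set.Icc 0 T, value μ σ r η κ T W 𝓕 P t 0 = κ)) ∧
    (∀ x : ℝ, AntitoneOn (fun t ↦ value μ σ r η κ T W 𝓕 P t x) (Set.Icc 0 T)) ∧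
    (∀ t ∈ Set.Icc 0 T, AntitoneOn (fun x ↦ value μ σ r η κ T W 𝓕 P t x) (Set.Ici 0)) := by
  refine ⟨fun t _ x ↦ ⟨fun τ hτ ↦ ?_, isLUB_value hr⟩,
    ⟨fun x hx ↦ value_terminal hc h0 hx, fun t _ ↦ value_zero h0⟩,
    fun x ↦ (value_antitone_time hr).antitoneOn _,
    fun t _ ↦ value_antitoneOn_space hW hc h0 hr hκ hηκ⟩
  exact integrable_reward hr (aemeasurable_absorptionTime hW hc) hτ.1.measurable'.aemeasurable

open DividendStopping in
theorem proposition5p1 {Ω : Type*} [mΩ : MeasurableSpace Ω] (P : Measure Ω)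
    [IsProbabilityMeasure P] [P.IsComplete] (𝓕 : Filtration ℝ≥0 mΩ) (h𝓕 : UsualConditions 𝓕 P)
    (W : ℝ≥0 → Ω → ℝ) (hW : IsFilteredBrownian W 𝓕 P)
    (μ σ r η κ : ℝ) (hσ : 0 < σ) (hr : 0 < r) (hη : 0 ≤ η) (hκ : η < κ)
    (T : ℝ≥0) (hT : 0 < T) :
    -- the optimal stopping problem is well posed
    (∀ t ∈ Set.Icc 0 T, ∀ x : ℝ, 0 ≤ x →
      (∀ τ ∈ stoppingTimes 𝓕 P (T - t), Integrable (reward μ σ r η κ W x τ) P) ∧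
      IsLUB (expectedRewards μ σ r η κ T W 𝓕 P t x) (value μ σ r η κ T W 𝓕 P t x)) ∧
    -- (i)
    ((∀ x : ℝ, 0 < x → value μ σ r η κ T W 𝓕 P T x = η) ∧
      (∀ t ∈ Set.Icc 0 T, value μ σ r η κ T W 𝓕 P t 0 = κ)) ∧
    -- (ii)
    (∀ x : ℝ, 0 < x → AntitoneOn (fun t ↦ value μ σ r η κ T W 𝓕 P t x) (Set.Icc 0 T)) ∧
    -- (iii)
    (∀ t ∈ Set.Icc 0 T, AntitoneOn (fun x ↦ value μ σ r η κ T W 𝓕 P t x) (Set.Ici 0)) := by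
  obtain ⟨hwell, ⟨hend, hzero⟩, htime, hspace⟩ :=
    proposition5p1_general P 𝓕 W hW.aemeasurable hW.cont hW.eval_zero_ae_eq_zero μ σ r η κ hr.le
      (hη.trans hκ.le) hκ.le T
  exact ⟨fun t ht x _ ↦ hwell t ht x, ⟨fun x hx ↦ hend x hx.ne', hzero⟩, fun x _ ↦ htime x,
    hspace⟩
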